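/- Let $c_1 = 2$ and $c_2 = (\log 3 - 1)/40 > 0$. These are universal constants with the following property. Let $m > 1$ be real, let $d \ge 2$ be an integer, and let $p$ be a probability distribution on $\{0,1,\dots,d\}$ with mean $m$. Let $(\xi_{n,i})_{n\ge 0,\, i\ge 1}$ be independent random variables with distribution $p$, and let $(Z_n)_{n\ge 0}$ be the Galton–Watson process defined by $Z_0 = 1$ and $Z_{n+1} = \sum_{i=1}^{Z_n} \xi_{n,i}$. Put $W_n = Z_n/m^n$ for $n \in \mathbb{N} = \{0,1,2,\dots\}$. Then $W_n$ converges almost surely to a finite limit $W_\infty$, and for every $n \in \mathbb{N}\cup\{\infty\}$ and every real $x \ge 0$, $$\mathbb{P}(W_n \ge x) \le c_1 \exp\left(-c_2\, \frac{m-1}{m}\, \frac{x}{d}\right).$$ -/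

import Mathlib

open MeasureTheory ProbabilityTheory Filter Topology

/-- The Galton–Watson process driven by the array `ξ`, where `ξ n i` is the number of children
of the `i`-th individual (counted from `0`) of generation `n`. -/
def gwSize {Ω : Type*} (ξ : ℕ → ℕ → Ω → ℕ) : ℕ → Ω → ℕ
  | 0, _ => 1
  | n + 1, ω => ∑ i ∈ Finset.range (gwSize ξ n ω), ξ n i ω

/-- The normalized process `W n = Z n / m ^ n` for finite `n`, and `W ∞ = lim W n`
(an arbitrary value where the limit does not exist). -/
noncomputable def gwNormalized {Ω : Type*} (m : ℝ) (ξ : ℕ → ℕ → Ω → ℕ) : ℕ∞ → Ω → ℝ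
  | ⊤, ω => limUnder atTop (fun n : ℕ => (gwSize ξ n ω : ℝ) / m ^ n)
  | (n : ℕ), ω => (gwSize ξ n ω : ℝ) / m ^ n

theorem gwNormalized_top {Ω : Type*} (m : ℝ) (ξ : ℕ → ℕ → Ω → ℕ) (ω : Ω) :
    gwNormalized m ξ ⊤ ω = limUnder atTop (fun n : ℕ => (gwSize ξ n ω : ℝ) / m ^ n) := rfl

theorem gwNormalized_coe {Ω : Type*} (m : ℝ) (ξ : ℕ → ℕ → Ω → ℕ) (n : ℕ) (ω : Ω) :
    gwNormalized m ξ (n : ℕ∞) ω = (gwSize ξ n ω : ℝ) / m ^ n := rfl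

/-! For `b ≥ 0`, the bound `𝔼 exp (t X) ≤ exp (a t / (1 - b t))` is stable under everything the
process does: independent sums add the `a`'s, a random sum composes the Möbius maps
`t ↦ a t / (1 - b t)`, scaling conjugates them, and limits preserve the bound by Fatou's lemma. An
offspring number in `[0, d]` of mean `m` satisfies it with `(a, b) = (m, d)`, so `Z_n` satisfies it
with the `n`-th iterate `(m ^ n, d (1 + m + ⋯ + m ^ (n - 1)))`, and every `W_n`, `n ≤ ∞`, satisfies
it with `(1, d / (m - 1))`. Chernoff's inequality at `t = (m - 1) / (3 d)` is the tail bound, and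
almost sure convergence is that of a nonnegative supermartingale.
-/

open scoped ENNReal

section Freezing

variable {Ω : Type*} {𝒢 mΩ : MeasurableSpace Ω} {μ : Measure Ω}

theorem setLIntegral_eq_measure_mul_lintegral_of_indep (h𝒢 : 𝒢 ≤ mΩ)
    {f : Ω → ℝ≥0∞} (hf : Measurable f) (hind : Indep 𝒢 (MeasurableSpace.comap f inferInstance) μ)
    {A : Set Ω} (hA : MeasurableSet[𝒢] A) : ∫⁻ ω in A, f ω ∂μ = μ A * ∫⁻ ω, f ω ∂μ := by
  have hprod := lintegral_mul_eq_lintegral_mul_lintegral_of_independent_measurableSpace h𝒢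
    hf.comap_le hind ((@measurable_one ℝ≥0∞ Ω _ 𝒢 _).indicator hA) (comap_measurable f)
  have hindicator : (fun ω => A.indicator 1 ω * f ω) = A.indicator f := by
    ext ω
    by_cases hω : ω ∈ A <;> simp [hω]
  rwa [hindicator, lintegral_indicator (h𝒢 A hA), lintegral_indicator_one (h𝒢 A hA)] at hprod

theorem setLIntegral_comp_index (h𝒢 : 𝒢 ≤ mΩ) {N : Ω → ℕ}
    (hN : Measurable[𝒢] N) {f : ℕ → Ω → ℝ≥0∞} (hf : ∀ k, Measurable (f k))
    (hind : ∀ k, Indep 𝒢 (MeasurableSpace.comap (f k) inferInstance) μ)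
    {A : Set Ω} (hA : MeasurableSet[𝒢] A) :
    ∫⁻ ω in A, f (N ω) ω ∂μ = ∫⁻ ω in A, ∫⁻ ω', f (N ω) ω' ∂μ ∂μ := by
  have hfiber : ∀ k, MeasurableSet[𝒢] (A ∩ N ⁻¹' {k}) := fun k =>
    hA.inter (hN (measurableSet_singleton k))
  have hdisj : Pairwise (Function.onFun Disjoint fun k => A ∩ N ⁻¹' {k}) := fun k l hkl =>
    Set.disjoint_left.2 fun ω hk hl => hkl (hk.2.symm.trans hl.2)
  have hunion : ⋃ k, A ∩ N ⁻¹' {k} = A := by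
    rw [← Set.inter_iUnion, ← Set.preimage_iUnion, Set.iUnion_of_singleton, Set.preimage_univ,
      Set.inter_univ]
  have hsplit : ∀ g : ℕ → Ω → ℝ≥0∞,
      ∫⁻ ω in A, g (N ω) ω ∂μ = ∑' k, ∫⁻ ω in A ∩ N ⁻¹' {k}, g k ω ∂μ := fun g => by
    conv_lhs => rw [← hunion, lintegral_iUnion (fun k => h𝒢 _ (hfiber k)) hdisj]
    refine tsum_congr fun k => setLIntegral_congr_fun (h𝒢 _ (hfiber k)) ?_
    rintro ω ⟨-, rfl⟩
    rfl
  rw [hsplit f, hsplit fun k _ => ∫⁻ ω', f k ω' ∂μ]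
  refine tsum_congr fun k => ?_
  rw [setLIntegral_eq_measure_mul_lintegral_of_indep h𝒢 (hf k) (hind k) (hfiber k),
    setLIntegral_const, mul_comm]

end Freezing

section MobiusMGF

variable {Ω : Type*} {mΩ : MeasurableSpace Ω} {μ : Measure Ω}

/-- The moment generating function of `X` is dominated by `exp (a t / (1 - b t))` for
`0 ≤ t` and `b t < 1`: the one of a Poisson number of independent exponential variables of mean
`b`, of total mean `a`. It is stated with the Lebesgue integral, so that the bound includes the
integrability of `exp (t X)`. -/
def HasMobiusMGF (X : Ω → ℝ) (a b : ℝ) (μ : Measure Ω) : Prop :=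
  ∀ t, 0 ≤ t → b * t < 1 →
    ∫⁻ ω, ENNReal.ofReal (Real.exp (t * X ω)) ∂μ ≤
      ENNReal.ofReal (Real.exp (a * t / (1 - b * t)))

theorem exp_mul_le_one_add_mul_div {x b t : ℝ} (hx : x ∈ Set.Icc 0 b) (ht : 0 ≤ t)
    (hbt : b * t < 1) : Real.exp (t * x) ≤ 1 + x * (t / (1 - b * t)) := by
  obtain ⟨hx0, hxb⟩ := hx
  have hle : t * x ≤ b * t := by
    rw [mul_comm b]
    gcongr
  have : 0 < 1 - b * t := sub_pos.2 hbt
  calc Real.exp (t * x) ≤ 1 / (1 - t * x) :=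
        Real.exp_bound_div_one_sub_of_interval (by positivity) (by linarith)
    _ = 1 + t * x / (1 - t * x) := by
        have : 1 - t * x ≠ 0 := by linarith
        field_simp
        ring
    _ ≤ 1 + t * x / (1 - b * t) := by gcongr
    _ = 1 + x * (t / (1 - b * t)) := by ring

namespace HasMobiusMGF

variable {X : Ω → ℝ} {a b : ℝ}

theorem of_ae_mem_Icc [IsProbabilityMeasure μ] (hX : AEMeasurable X μ)
    (hXb : ∀ᵐ ω ∂μ, X ω ∈ Set.Icc 0 b) (ha : ∫ ω, X ω ∂μ ≤ a) : HasMobiusMGF X a b μ := by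
  intro t ht hbt
  have : 0 < 1 - b * t := sub_pos.2 hbt
  have hint : Integrable (fun ω => X ω * (t / (1 - b * t))) μ :=
    (Integrable.of_mem_Icc 0 b hX hXb).mul_const _
  have haffine : Integrable (fun ω => 1 + X ω * (t / (1 - b * t))) μ :=
    (integrable_const 1).add hint
  have hnonneg : 0 ≤ᵐ[μ] fun ω => 1 + X ω * (t / (1 - b * t)) := by
    filter_upwards [hXb] with ω hω
    have := hω.1
    positivity
  calc ∫⁻ ω, ENNReal.ofReal (Real.exp (t * X ω)) ∂μ
      ≤ ∫⁻ ω, ENNReal.ofReal (1 + X ω * (t / (1 - b * t))) ∂μ := by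
        refine lintegral_mono_ae ?_
        filter_upwards [hXb] with ω hω
        exact ENNReal.ofReal_le_ofReal (exp_mul_le_one_add_mul_div hω ht hbt)
    _ = ENNReal.ofReal (1 + (∫ ω, X ω ∂μ) * (t / (1 - b * t))) := by
        rw [← ofReal_integral_eq_lintegral_ofReal haffine hnonneg,
          integral_add (integrable_const 1) hint, integral_mul_const]
        simp
    _ ≤ ENNReal.ofReal (1 + a * t / (1 - b * t)) := by
        rw [mul_div_assoc]
        gcongr
    _ ≤ ENNReal.ofReal (Real.exp (a * t / (1 - b * t))) := by
        rw [add_comm]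
        exact ENNReal.ofReal_le_ofReal (Real.add_one_le_exp _)

theorem const_one [IsProbabilityMeasure μ] : HasMobiusMGF (fun _ => (1 : ℝ)) 1 0 μ := by
  intro t _ _
  simp

theorem mono {b' : ℝ} (h : HasMobiusMGF X a b μ) (ha : 0 ≤ a) (hbb' : b ≤ b') :
    HasMobiusMGF X a b' μ := by
  intro t ht hbt
  have hle : b * t ≤ b' * t := by gcongr
  refine (h t ht (by linarith)).trans ?_
  have : 0 < 1 - b' * t := by linarith
  gcongr

theorem const_mul {c : ℝ} (h : HasMobiusMGF X a b μ) (hc : 0 ≤ c) :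
    HasMobiusMGF (fun ω => c * X ω) (c * a) (c * b) μ := by
  intro t ht hbt
  have hct := h (c * t) (by positivity) (by linarith)
  convert hct using 4 <;> ring_nf

theorem sum {ι : Type*} {X : ι → Ω → ℝ} {a : ι → ℝ} (hind : iIndepFun X μ)
    (hX : ∀ i, Measurable (X i)) (h : ∀ i, HasMobiusMGF (X i) (a i) b μ) (s : Finset ι) :
    HasMobiusMGF (fun ω => ∑ i ∈ s, X i ω) (∑ i ∈ s, a i) b μ := by
  intro t ht hbt
  have hexp : Measurable fun x : ℝ => ENNReal.ofReal (Real.exp (t * x)) := by fun_prop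
  calc ∫⁻ ω, ENNReal.ofReal (Real.exp (t * ∑ i ∈ s, X i ω)) ∂μ
      = ∫⁻ ω, ∏ i ∈ s, ENNReal.ofReal (Real.exp (t * X i ω)) ∂μ := by
        simp only [Finset.mul_sum, Real.exp_sum,
          ENNReal.ofReal_prod_of_nonneg fun _ _ => Real.exp_nonneg _]
    _ = ∏ i ∈ s, ∫⁻ ω, ENNReal.ofReal (Real.exp (t * X i ω)) ∂μ :=
        lintegral_prod_eq_prod_lintegral_of_indepFun s _ (hind.comp _ fun _ => hexp)
          fun i => hexp.comp (hX i)
    _ ≤ ∏ i ∈ s, ENNReal.ofReal (Real.exp (a i * t / (1 - b * t))) :=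
        Finset.prod_le_prod' fun i _ => h i t ht hbt
    _ = ENNReal.ofReal (Real.exp ((∑ i ∈ s, a i) * t / (1 - b * t))) := by
        rw [← ENNReal.ofReal_prod_of_nonneg fun _ _ => Real.exp_nonneg _, ← Real.exp_sum,
          Finset.sum_mul, Finset.sum_div]

-- Conditioning on `N` composes the two Möbius maps, `u = a t / (1 - b t)` being fed to the first.
theorem comp_index {N : Ω → ℕ} {S : ℕ → Ω → ℝ} {p q : ℝ}
    (hN : HasMobiusMGF (fun ω => (N ω : ℝ)) p q μ) (hS : ∀ k, HasMobiusMGF (S k) (k * a) b μ)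
    (ha : 0 ≤ a) (hq : 0 ≤ q) (hNm : Measurable N) (hSm : ∀ k, Measurable (S k))
    (hind : ∀ k, IndepFun N (S k) μ) :
    HasMobiusMGF (fun ω => S (N ω) ω) (p * a) (q * a + b) μ := by
  intro t ht hbt
  have hqat : 0 ≤ q * a * t := by positivity
  have hbt0 : 0 < 1 - b * t := by linarith
  have hexp : Measurable fun x : ℝ => ENNReal.ofReal (Real.exp (t * x)) := by fun_prop
  set u := a * t / (1 - b * t) with hu
  have hu0 : 0 ≤ u := by positivity
  have hqu : q * u < 1 := by
    rw [hu, ← mul_div_assoc, div_lt_one hbt0]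
    linarith
  have hcomp : p * u / (1 - q * u) = p * a * t / (1 - (q * a + b) * t) := by
    have h1 : 1 - q * u ≠ 0 := by linarith
    have h2 : 1 - (q * a + b) * t ≠ 0 := by linarith
    have h3 : u * (1 - b * t) = a * t := div_mul_cancel₀ _ hbt0.ne'
    rw [div_eq_div_iff h1 h2]
    linear_combination p * h3
  calc ∫⁻ ω, ENNReal.ofReal (Real.exp (t * S (N ω) ω)) ∂μ
      = ∫⁻ ω, ∫⁻ ω', ENNReal.ofReal (Real.exp (t * S (N ω) ω')) ∂μ ∂μ := by
        have hfreeze := setLIntegral_comp_index (μ := μ) hNm.comap_le (comap_measurable N)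
          (fun k => hexp.comp (hSm k))
          (fun k => (IndepFun_iff_Indep _ _ _).1 ((hind k).comp measurable_id hexp))
          MeasurableSet.univ
        simpa only [setLIntegral_univ, Function.comp_apply] using hfreeze
    _ ≤ ∫⁻ ω, ENNReal.ofReal (Real.exp (u * N ω)) ∂μ := by
        refine lintegral_mono fun ω => (hS (N ω) t ht (by linarith)).trans_eq ?_
        rw [hu]
        ring_nf
    _ ≤ ENNReal.ofReal (Real.exp (p * u / (1 - q * u))) := hN u hu0 hqu
    _ = _ := by rw [hcomp]

theorem of_ae_tendsto {X : ℕ → Ω → ℝ} {Y : Ω → ℝ} (h : ∀ n, HasMobiusMGF (X n) a b μ)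
    (hX : ∀ n, AEMeasurable (X n) μ)
    (hlim : ∀ᵐ ω ∂μ, Tendsto (fun n => X n ω) atTop (𝓝 (Y ω))) : HasMobiusMGF Y a b μ := by
  intro t ht hbt
  have hexp : Continuous fun x : ℝ => ENNReal.ofReal (Real.exp (t * x)) :=
    ENNReal.continuous_ofReal.comp (by fun_prop)
  calc ∫⁻ ω, ENNReal.ofReal (Real.exp (t * Y ω)) ∂μ
      = ∫⁻ ω, liminf (fun n => ENNReal.ofReal (Real.exp (t * X n ω))) atTop ∂μ := by
        refine lintegral_congr_ae ?_
        filter_upwards [hlim] with ω hω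
        exact ((hexp.tendsto _).comp hω).liminf_eq.symm
    _ ≤ liminf (fun n => ∫⁻ ω, ENNReal.ofReal (Real.exp (t * X n ω)) ∂μ) atTop :=
        lintegral_liminf_le' fun n => hexp.measurable.comp_aemeasurable (hX n)
    _ ≤ liminf (fun _ : ℕ => ENNReal.ofReal (Real.exp (a * t / (1 - b * t)))) atTop :=
        liminf_le_liminf (Eventually.of_forall fun n => h n t ht hbt)
    _ = _ := liminf_const _

-- The mean is read off the exponential moments as their slope at `t = 0`.
theorem lintegral_le [IsProbabilityMeasure μ] (h : HasMobiusMGF X a b μ) (hX : 0 ≤ X) :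
    ∫⁻ ω, ENNReal.ofReal (X ω) ∂μ ≤ ENNReal.ofReal a := by
  set g : ℝ → ℝ := fun t => Real.exp (a * t / (1 - b * t))
  have hderiv : HasDerivAt g a 0 := by
    have hnum : HasDerivAt (fun t => a * t) (a * 1) 0 := (hasDerivAt_id 0).const_mul a
    have hden : HasDerivAt (fun t => 1 - b * t) (-(b * 1)) 0 :=
      ((hasDerivAt_id 0).const_mul b).const_sub 1
    simpa using (hnum.div hden (by simp)).exp
  have hslope := ENNReal.tendsto_ofReal hderiv.tendsto_slope_zero_right
  have hsmall : ∀ᶠ t in 𝓝[>] (0 : ℝ), b * t < 1 :=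
    nhdsWithin_le_nhds (ContinuousAt.eventually_lt (by fun_prop) continuousAt_const (by simp))
  refine ge_of_tendsto hslope ?_
  filter_upwards [hsmall, self_mem_nhdsWithin] with t hbt ht
  have ht0 : 0 < t := ht
  have hlin : 1 + ENNReal.ofReal t * ∫⁻ ω, ENNReal.ofReal (X ω) ∂μ ≤ ENNReal.ofReal (g t) :=
    calc 1 + ENNReal.ofReal t * ∫⁻ ω, ENNReal.ofReal (X ω) ∂μ
        = ∫⁻ ω, ENNReal.ofReal (t * X ω + 1) ∂μ := by
          simp only [ENNReal.ofReal_add (mul_nonneg ht0.le (hX _)) zero_le_one,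
            ENNReal.ofReal_mul ht0.le, ENNReal.ofReal_one]
          rw [lintegral_add_right _ measurable_const,
            lintegral_const_mul' _ _ ENNReal.ofReal_ne_top, lintegral_one, measure_univ, add_comm]
      _ ≤ ∫⁻ ω, ENNReal.ofReal (Real.exp (t * X ω)) ∂μ :=
          lintegral_mono fun ω => ENNReal.ofReal_le_ofReal (Real.add_one_le_exp _)
      _ ≤ ENNReal.ofReal (g t) := h t ht0.le hbt
  have hg0 : g 0 = 1 := by simp [g]
  rw [smul_eq_mul, zero_add, hg0, ← div_eq_inv_mul, ENNReal.ofReal_div_of_pos ht0,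
    ENNReal.le_div_iff_mul_le (by simp [ht0]) (by simp), ENNReal.ofReal_sub _ zero_le_one,
    ENNReal.ofReal_one, mul_comm]
  exact ENNReal.le_sub_of_add_le_left ENNReal.one_ne_top hlin

theorem measureReal_ge_le [IsFiniteMeasure μ] (h : HasMobiusMGF X a b μ) (hX : AEMeasurable X μ)
    {t : ℝ} (ht : 0 ≤ t) (hbt : b * t < 1) (x : ℝ) :
    μ.real {ω | x ≤ X ω} ≤ Real.exp (a * t / (1 - b * t)) * Real.exp (-t * x) := by
  have hmeas : AEStronglyMeasurable (fun ω => Real.exp (t * X ω)) μ :=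
    (hX.const_mul t).exp.aestronglyMeasurable
  have hnonneg : 0 ≤ᵐ[μ] fun ω => Real.exp (t * X ω) := ae_of_all _ fun _ => Real.exp_nonneg _
  have hint : Integrable (fun ω => Real.exp (t * X ω)) μ :=
    ⟨hmeas, (hasFiniteIntegral_iff_ofReal hnonneg).2 ((h t ht hbt).trans_lt ENNReal.ofReal_lt_top)⟩
  have hmgf : mgf X μ t ≤ Real.exp (a * t / (1 - b * t)) := by
    rw [mgf, integral_eq_lintegral_of_nonneg_ae hnonneg hmeas]
    exact ENNReal.toReal_le_of_le_ofReal (Real.exp_nonneg _) (h t ht hbt)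
  calc μ.real {ω | x ≤ X ω} ≤ Real.exp (-t * x) * mgf X μ t := measure_ge_le_exp_mul_mgf x ht hint
    _ ≤ Real.exp (-t * x) * Real.exp (a * t / (1 - b * t)) := by gcongr
    _ = _ := mul_comm _ _

theorem comp_of_map {Ω' : Type*} {mΩ' : MeasurableSpace Ω'} {f : Ω → Ω'} {Y : Ω' → ℝ}
    (hf : AEMeasurable f μ) (h : HasMobiusMGF Y a b (μ.map f)) (hY : Measurable Y) :
    HasMobiusMGF (fun ω => Y (f ω)) a b μ := fun t ht hbt => by
  have hexp : Measurable fun y => ENNReal.ofReal (Real.exp (t * Y y)) := by fun_prop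
  exact (lintegral_map' hexp.aemeasurable hf).symm.trans_le (h t ht hbt)

end HasMobiusMGF

end MobiusMGF

section GaltonWatson

variable {Ω : Type*} {mΩ : MeasurableSpace Ω} {μ : Measure Ω} {ξ : ℕ → ℕ → Ω → ℕ} {m d : ℝ}

theorem gwSize_succ_cast (ξ : ℕ → ℕ → Ω → ℕ) (n : ℕ) (ω : Ω) :
    (gwSize ξ (n + 1) ω : ℝ) = ∑ i ∈ Finset.range (gwSize ξ n ω), (ξ n i ω : ℝ) := by
  simp only [gwSize, Nat.cast_sum]

theorem gwNormalized_nonneg (hm : 0 ≤ m) (n : ℕ) : 0 ≤ gwNormalized m ξ n := fun ω => by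
  rw [gwNormalized_coe]
  exact div_nonneg (Nat.cast_nonneg _) (pow_nonneg hm n)

theorem measurable_gwSize {n : ℕ} (hξ : ∀ k < n, ∀ i, Measurable (ξ k i)) :
    Measurable (gwSize ξ n) := by
  induction n with
  | zero => exact measurable_const
  | succ n ih =>
    have hsum : Measurable fun a : ℕ × Ω => ∑ i ∈ Finset.range a.1, ξ n i a.2 :=
      measurable_from_prod_countable_right fun k =>
        Finset.measurable_fun_sum (Finset.range k) fun i _ => hξ n n.lt_succ_self i
    exact hsum.comp ((ih fun k hk => hξ k (hk.trans n.lt_succ_self)).prodMk measurable_id)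

theorem measurable_gwNormalized {n : ℕ} (hξ : ∀ k < n, ∀ i, Measurable (ξ k i)) :
    Measurable (gwNormalized m ξ n) := by
  have hcast : Measurable fun k : ℕ => (k : ℝ) := measurable_from_nat
  exact (hcast.comp (measurable_gwSize hξ)).div_const _

/-- The filtration of the generations: the `n`-th σ-algebra is generated by the offspring numbers
of the generations strictly before `n`, which determine the size of generation `n`. -/
def offspringFiltration (hξ : ∀ n i, Measurable (ξ n i)) : Filtration ℕ mΩ where
  seq n := ⨆ q ∈ {q : ℕ × ℕ | q.1 < n}, MeasurableSpace.comap (ξ q.1 q.2) inferInstance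
  mono' _ _ hnk := biSup_mono fun _ hq => lt_of_lt_of_le hq hnk
  le' _ := iSup₂_le fun q _ => (hξ q.1 q.2).comap_le

theorem measurable_offspringFiltration (hξ : ∀ n i, Measurable (ξ n i)) {k n : ℕ} (hkn : k < n)
    (i : ℕ) : Measurable[offspringFiltration hξ n] (ξ k i) :=
  measurable_iff_comap_le.2 (le_iSup₂_of_le (k, i) hkn le_rfl)

theorem indep_offspringFiltration_sum (hξ : ∀ n i, Measurable (ξ n i))
    (hind : iIndepFun (fun q : ℕ × ℕ => ξ q.1 q.2) μ) (n k : ℕ) :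
    Indep (offspringFiltration hξ n)
      (MeasurableSpace.comap (fun ω => ∑ i ∈ Finset.range k, (ξ n i ω : ℝ)) inferInstance) μ := by
  have hdisj : Disjoint {q : ℕ × ℕ | q.1 < n} {q : ℕ × ℕ | q.1 = n} :=
    Set.disjoint_left.2 fun q hq hq' => hq.ne hq'
  have hgenerations := indep_iSup_of_disjoint (fun q : ℕ × ℕ => (hξ q.1 q.2).comap_le)
    hind.iIndep hdisj
  refine indep_of_indep_of_le_right hgenerations ?_
  rw [← measurable_iff_comap_le]
  refine Finset.measurable_fun_sum _ fun i _ => measurable_from_nat.comp ?_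
  exact measurable_iff_comap_le.2 (le_iSup₂_of_le (n, i) rfl le_rfl)

theorem hasMobiusMGF_offspring_sum (hξ : ∀ n i, Measurable (ξ n i))
    (hmgf : ∀ n i, HasMobiusMGF (fun ω => (ξ n i ω : ℝ)) m d μ)
    (hind : iIndepFun (fun q : ℕ × ℕ => ξ q.1 q.2) μ) (n k : ℕ) :
    HasMobiusMGF (fun ω => ∑ i ∈ Finset.range k, (ξ n i ω : ℝ)) (k * m) d μ := by
  have hind' : iIndepFun (fun i ω => (ξ n i ω : ℝ)) μ :=
    (hind.precomp (g := fun i : ℕ => (n, i)) fun _ _ h => (Prod.ext_iff.1 h).2).comp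
      (fun _ (k : ℕ) => (k : ℝ)) fun _ => measurable_from_nat
  simpa using HasMobiusMGF.sum hind' (fun i => measurable_from_nat.comp (hξ n i)) (hmgf n)
    (Finset.range k)

theorem hasMobiusMGF_gwSize [IsProbabilityMeasure μ] (hm : 0 ≤ m) (hd : 0 ≤ d)
    (hξ : ∀ n i, Measurable (ξ n i)) (hmgf : ∀ n i, HasMobiusMGF (fun ω => (ξ n i ω : ℝ)) m d μ)
    (hind : iIndepFun (fun q : ℕ × ℕ => ξ q.1 q.2) μ) (n : ℕ) :
    HasMobiusMGF (fun ω => (gwSize ξ n ω : ℝ)) (m ^ n) (d * ∑ k ∈ Finset.range n, m ^ k) μ := by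
  induction n with
  | zero => simpa [gwSize] using HasMobiusMGF.const_one
  | succ n ih =>
    have hindep : ∀ k, IndepFun (gwSize ξ n) (fun ω => ∑ i ∈ Finset.range k, (ξ n i ω : ℝ)) μ :=
      fun k => (IndepFun_iff_Indep _ _ _).2 <|
        indep_of_indep_of_le_left (indep_offspringFiltration_sum hξ hind n k)
          (measurable_gwSize fun _ hk => measurable_offspringFiltration hξ hk).comap_le
    have hstep := ih.comp_index (hasMobiusMGF_offspring_sum hξ hmgf hind n) hm (by positivity)
      (measurable_gwSize fun k _ => hξ k)
      (fun k => Finset.measurable_fun_sum _ fun i _ => measurable_from_nat.comp (hξ n i)) hindep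
    have hscale : d * ∑ k ∈ Finset.range (n + 1), m ^ k =
        (d * ∑ k ∈ Finset.range n, m ^ k) * m + d := by
      rw [geom_sum_succ]
      ring
    simpa only [gwSize_succ_cast, pow_succ, hscale] using hstep

theorem hasMobiusMGF_gwNormalized_coe [IsProbabilityMeasure μ] (hm : 0 < m) (hd : 0 ≤ d)
    (hξ : ∀ n i, Measurable (ξ n i)) (hmgf : ∀ n i, HasMobiusMGF (fun ω => (ξ n i ω : ℝ)) m d μ)
    (hind : iIndepFun (fun q : ℕ × ℕ => ξ q.1 q.2) μ) (n : ℕ) :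
    HasMobiusMGF (gwNormalized m ξ n) 1 ((m ^ n)⁻¹ * (d * ∑ k ∈ Finset.range n, m ^ k)) μ := by
  have hscaled := (hasMobiusMGF_gwSize hm.le hd hξ hmgf hind n).const_mul
    (c := (m ^ n)⁻¹) (by positivity)
  rw [inv_mul_cancel₀ (by positivity)] at hscaled
  simp only [← div_eq_inv_mul] at hscaled ⊢
  exact hscaled

theorem setLIntegral_gwNormalized_succ_le [IsProbabilityMeasure μ] (hm : 0 < m)
    (hξ : ∀ n i, Measurable (ξ n i)) (hmgf : ∀ n i, HasMobiusMGF (fun ω => (ξ n i ω : ℝ)) m d μ)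
    (hind : iIndepFun (fun q : ℕ × ℕ => ξ q.1 q.2) μ) {n : ℕ} {A : Set Ω}
    (hA : MeasurableSet[offspringFiltration hξ n] A) :
    ∫⁻ ω in A, ENNReal.ofReal (gwNormalized m ξ (n + 1 : ℕ) ω) ∂μ ≤
      ∫⁻ ω in A, ENNReal.ofReal (gwNormalized m ξ n ω) ∂μ := by
  set S : ℕ → Ω → ℝ := fun k ω => ∑ i ∈ Finset.range k, (ξ n i ω : ℝ)
  have hscale : Measurable fun x : ℝ => ENNReal.ofReal (x / m ^ (n + 1)) := by fun_prop
  have hS : ∀ k, Measurable (S k) := fun k =>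
    Finset.measurable_fun_sum _ fun i _ => measurable_from_nat.comp (hξ n i)
  have hmean : ∀ k : ℕ, ∫⁻ ω, ENNReal.ofReal (S k ω / m ^ (n + 1)) ∂μ ≤
      ENNReal.ofReal (k / m ^ n) := fun k => by
    have hW := (hasMobiusMGF_offspring_sum hξ hmgf hind n k).const_mul
      (c := (m ^ (n + 1))⁻¹) (by positivity)
    have hle := hW.lintegral_le fun ω => by positivity
    have hcancel : (m ^ (n + 1))⁻¹ * (k * m) = k / m ^ n := by
      rw [pow_succ]
      field_simp
    simpa only [hcancel, ← div_eq_inv_mul] using hle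
  calc ∫⁻ ω in A, ENNReal.ofReal (gwNormalized m ξ (n + 1 : ℕ) ω) ∂μ
      = ∫⁻ ω in A, ENNReal.ofReal (S (gwSize ξ n ω) ω / m ^ (n + 1)) ∂μ := by
        simp only [gwNormalized_coe, gwSize_succ_cast, S]
    _ = ∫⁻ ω in A, ∫⁻ ω', ENNReal.ofReal (S (gwSize ξ n ω) ω' / m ^ (n + 1)) ∂μ ∂μ :=
        setLIntegral_comp_index ((offspringFiltration hξ).le n)
          (measurable_gwSize fun _ hk => measurable_offspringFiltration hξ hk)
          (fun k => hscale.comp (hS k))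
          (fun k => indep_of_indep_of_le_right (indep_offspringFiltration_sum hξ hind n k)
            (hscale.comp (comap_measurable (S k))).comap_le) hA
    _ ≤ ∫⁻ ω in A, ENNReal.ofReal (gwNormalized m ξ n ω) ∂μ :=
        lintegral_mono fun ω => hmean (gwSize ξ n ω)

theorem lintegral_gwNormalized_le_one [IsProbabilityMeasure μ] (hm : 0 < m) (hd : 0 ≤ d)
    (hξ : ∀ n i, Measurable (ξ n i)) (hmgf : ∀ n i, HasMobiusMGF (fun ω => (ξ n i ω : ℝ)) m d μ)
    (hind : iIndepFun (fun q : ℕ × ℕ => ξ q.1 q.2) μ) (n : ℕ) :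
    ∫⁻ ω, ENNReal.ofReal (gwNormalized m ξ n ω) ∂μ ≤ 1 := by
  simpa using (hasMobiusMGF_gwNormalized_coe hm hd hξ hmgf hind n).lintegral_le
    (gwNormalized_nonneg hm.le n)

theorem supermartingale_gwNormalized [IsProbabilityMeasure μ] (hm : 0 < m) (hd : 0 ≤ d)
    (hξ : ∀ n i, Measurable (ξ n i)) (hmgf : ∀ n i, HasMobiusMGF (fun ω => (ξ n i ω : ℝ)) m d μ)
    (hind : iIndepFun (fun q : ℕ × ℕ => ξ q.1 q.2) μ) :
    Supermartingale (fun n : ℕ => gwNormalized m ξ n) (offspringFiltration hξ) μ := by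
  have hnonneg : ∀ (n : ℕ) (ν : Measure Ω), 0 ≤ᵐ[ν] gwNormalized m ξ n := fun n _ =>
    ae_of_all _ (gwNormalized_nonneg hm.le n)
  have hmeas : ∀ (n : ℕ) (ν : Measure Ω), AEStronglyMeasurable (gwNormalized m ξ n) ν := fun n _ =>
    (measurable_gwNormalized fun k _ => hξ k).aestronglyMeasurable
  have hfin : ∀ n : ℕ, ∫⁻ ω, ENNReal.ofReal (gwNormalized m ξ n ω) ∂μ < ⊤ := fun n =>
    (lintegral_gwNormalized_le_one hm hd hξ hmgf hind n).trans_lt ENNReal.one_lt_top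
  refine supermartingale_of_setIntegral_succ_le
    (fun n => (measurable_gwNormalized fun _ hk =>
      measurable_offspringFiltration hξ hk).stronglyMeasurable)
    (fun n => ⟨hmeas n μ, (hasFiniteIntegral_iff_ofReal (hnonneg n μ)).2 (hfin n)⟩)
    fun n A hA => ?_
  rw [integral_eq_lintegral_of_nonneg_ae (hnonneg _ _) (hmeas _ _),
    integral_eq_lintegral_of_nonneg_ae (hnonneg _ _) (hmeas _ _)]
  exact ENNReal.toReal_mono ((setLIntegral_le_lintegral A _).trans_lt (hfin n)).ne
    (setLIntegral_gwNormalized_succ_le hm hξ hmgf hind hA)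

theorem ae_tendsto_gwNormalized [IsProbabilityMeasure μ] (hm : 0 < m) (hd : 0 ≤ d)
    (hξ : ∀ n i, Measurable (ξ n i)) (hmgf : ∀ n i, HasMobiusMGF (fun ω => (ξ n i ω : ℝ)) m d μ)
    (hind : iIndepFun (fun q : ℕ × ℕ => ξ q.1 q.2) μ) :
    ∀ᵐ ω ∂μ, Tendsto (fun n : ℕ => gwNormalized m ξ n ω) atTop (𝓝 (gwNormalized m ξ ⊤ ω)) := by
  have hbdd : ∀ n : ℕ, eLpNorm ((-fun n : ℕ => gwNormalized m ξ n) n) 1 μ ≤ (1 : NNReal) :=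
    fun n => by
      rw [Pi.neg_apply, eLpNorm_neg, eLpNorm_one_eq_lintegral_enorm]
      simpa only [Real.enorm_of_nonneg (gwNormalized_nonneg hm.le n _), ENNReal.coe_one] using
        lintegral_gwNormalized_le_one hm hd hξ hmgf hind n
  filter_upwards [(supermartingale_gwNormalized hm hd hξ hmgf hind).neg.exists_ae_tendsto_of_bdd
    hbdd] with ω hω
  obtain ⟨l, hl⟩ := hω
  have hneg := hl.neg
  simp only [Pi.neg_apply, neg_neg] at hneg
  exact tendsto_nhds_limUnder ⟨-l, hneg⟩

theorem aemeasurable_gwNormalized (hξ : ∀ n i, Measurable (ξ n i))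
    (hlim : ∀ᵐ ω ∂μ, Tendsto (fun n : ℕ => gwNormalized m ξ n ω) atTop
      (𝓝 (gwNormalized m ξ ⊤ ω))) (n : ℕ∞) : AEMeasurable (gwNormalized m ξ n) μ := by
  have hcoe : ∀ n : ℕ, AEMeasurable (gwNormalized m ξ n) μ := fun n =>
    (measurable_gwNormalized fun k _ => hξ k).aemeasurable
  induction n using ENat.recTopCoe with
  | coe n => exact hcoe n
  | top => exact aemeasurable_of_tendsto_metrizable_ae' hcoe hlim

theorem hasMobiusMGF_gwNormalized [IsProbabilityMeasure μ] (hm : 1 < m) (hd : 0 ≤ d)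
    (hξ : ∀ n i, Measurable (ξ n i)) (hmgf : ∀ n i, HasMobiusMGF (fun ω => (ξ n i ω : ℝ)) m d μ)
    (hind : iIndepFun (fun q : ℕ × ℕ => ξ q.1 q.2) μ) (n : ℕ∞) :
    HasMobiusMGF (gwNormalized m ξ n) 1 (d / (m - 1)) μ := by
  have hm0 : 0 < m := by linarith
  have hm1 : 0 < m - 1 := sub_pos.2 hm
  have hgeom : ∀ n : ℕ, (m ^ n)⁻¹ * (d * ∑ k ∈ Finset.range n, m ^ k) ≤ d / (m - 1) := fun n => by
    rw [geom_sum_eq hm.ne']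
    calc (m ^ n)⁻¹ * (d * ((m ^ n - 1) / (m - 1)))
        ≤ (m ^ n)⁻¹ * (d * (m ^ n / (m - 1))) := by gcongr; linarith
      _ = d / (m - 1) := by field_simp
  have hcoe : ∀ n : ℕ, HasMobiusMGF (gwNormalized m ξ n) 1 (d / (m - 1)) μ := fun n =>
    (hasMobiusMGF_gwNormalized_coe hm0 hd hξ hmgf hind n).mono zero_le_one (hgeom n)
  induction n using ENat.recTopCoe with
  | coe n => exact hcoe n
  | top =>
    exact HasMobiusMGF.of_ae_tendsto hcoe
      (fun n => (measurable_gwNormalized fun k _ => hξ k).aemeasurable)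
      (ae_tendsto_gwNormalized hm0 hd hξ hmgf hind)

theorem theorem1_general [IsProbabilityMeasure μ] (hm : 1 < m) (hmd : m ≤ d)
    (hξ : ∀ n i, Measurable (ξ n i)) (hmgf : ∀ n i, HasMobiusMGF (fun ω => (ξ n i ω : ℝ)) m d μ)
    (hind : iIndepFun (fun q : ℕ × ℕ => ξ q.1 q.2) μ) :
    (∀ᵐ ω ∂μ, Tendsto (fun n : ℕ => gwNormalized m ξ (n : ℕ∞) ω) atTop
        (𝓝 (gwNormalized m ξ ⊤ ω))) ∧
      ∀ (n : ℕ∞) (x : ℝ), μ.real {ω | x ≤ gwNormalized m ξ n ω} ≤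
        2 * Real.exp (-(1 / 3) * (m - 1) * (x / d)) := by
  have hm1 : 0 < m - 1 := sub_pos.2 hm
  have hd : 0 < d := by linarith
  have hlim := ae_tendsto_gwNormalized (by linarith) hd.le hξ hmgf hind
  refine ⟨hlim, fun n x => ?_⟩
  set t := (m - 1) / (3 * d) with ht
  have hthird : d / (m - 1) * t = 1 / 3 := by rw [ht]; field_simp
  have hprefactor : Real.exp (1 * t / (1 - d / (m - 1) * t)) ≤ 2 := by
    rw [← Real.le_log_iff_exp_le two_pos, hthird]
    have : t ≤ 1 / 3 := by
      rw [ht, div_le_div_iff₀ (by positivity) (by positivity)]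
      linarith
    rw [one_mul, div_le_iff₀ (by norm_num)]
    linarith [Real.log_two_gt_d9]
  calc μ.real {ω | x ≤ gwNormalized m ξ n ω}
      ≤ Real.exp (1 * t / (1 - d / (m - 1) * t)) * Real.exp (-t * x) :=
        (hasMobiusMGF_gwNormalized hm hd.le hξ hmgf hind n).measureReal_ge_le
          (aemeasurable_gwNormalized hξ hlim n) (by positivity) (by rw [hthird]; norm_num) x
    _ ≤ 2 * Real.exp (-t * x) := by gcongr
    _ = 2 * Real.exp (-(1 / 3) * (m - 1) * (x / d)) := by
        rw [ht]
        congr 2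
        field_simp

end GaltonWatson

theorem ae_le_of_forall_mem_support {p : PMF ℕ} {d : ℕ} (hp : ∀ k ∈ p.support, k ≤ d) :
    ∀ᵐ k ∂p.toMeasure, k ≤ d := by
  rw [ae_iff, p.toMeasure_apply_eq_zero_iff MeasurableSet.of_discrete]
  exact Set.disjoint_left.2 fun k hk hkd => hkd (hp k hk)

theorem ae_natCast_mem_Icc {p : PMF ℕ} {d : ℕ} (hp : ∀ k ∈ p.support, k ≤ d) :
    ∀ᵐ k : ℕ ∂p.toMeasure, (k : ℝ) ∈ Set.Icc 0 (d : ℝ) := by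
  filter_upwards [ae_le_of_forall_mem_support hp] with k hk
  exact ⟨k.cast_nonneg, Nat.cast_le.2 hk⟩

theorem integral_natCast_le {p : PMF ℕ} {d : ℕ} (hp : ∀ k ∈ p.support, k ≤ d) :
    ∫ k, (k : ℝ) ∂p.toMeasure ≤ d := by
  have hbound := ae_natCast_mem_Icc hp
  have hint : Integrable (fun k : ℕ => (k : ℝ)) p.toMeasure :=
    Integrable.of_mem_Icc 0 d measurable_from_nat.aemeasurable hbound
  simpa using integral_mono_ae hint (integrable_const (d : ℝ)) (hbound.mono fun _ hk => hk.2)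

theorem hasMobiusMGF_natCast {p : PMF ℕ} {d : ℕ} (hp : ∀ k ∈ p.support, k ≤ d) :
    HasMobiusMGF (fun k : ℕ => (k : ℝ)) (∫ k, (k : ℝ) ∂p.toMeasure) d p.toMeasure :=
  .of_ae_mem_Icc measurable_from_nat.aemeasurable (ae_natCast_mem_Icc hp) le_rfl

theorem log_three_sub_one_pos : 0 < Real.log 3 - 1 :=
  sub_pos.2 <| (Real.lt_log_iff_exp_lt three_pos).2 <| by linarith [Real.exp_one_lt_d9]

theorem log_three_sub_one_div_mul_le {m : ℝ} (hm : 1 < m) :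
    (Real.log 3 - 1) / 40 * ((m - 1) / m) ≤ 1 / 3 * (m - 1) := by
  have hlog : (Real.log 3 - 1) / 40 ≤ 1 / 3 := by
    linarith [Real.log_le_sub_one_of_pos (three_pos : (0 : ℝ) < 3)]
  have hdiv : (m - 1) / m ≤ m - 1 := div_le_self (by linarith) hm.le
  gcongr

theorem theorem1 :
    ∃ c₁ c₂ : ℝ, 0 < c₁ ∧ 0 < c₂ ∧ c₁ = 2 ∧ c₂ = (Real.log 3 - 1) / 40 ∧
      ∀ (m : ℝ) (d : ℕ) (p : PMF ℕ), 1 < m → 2 ≤ d →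
        (∀ k ∈ p.support, k ≤ d) → (∫ k, (k : ℝ) ∂p.toMeasure) = m →
        ∀ {Ω : Type*} [MeasurableSpace Ω] (μ : Measure Ω) [IsProbabilityMeasure μ]
          (ξ : ℕ → ℕ → Ω → ℕ),
          (∀ n i, Measurable (ξ n i)) →
          (∀ n i, μ.map (ξ n i) = p.toMeasure) →
          iIndepFun (fun q : ℕ × ℕ => ξ q.1 q.2) μ →
          (∀ᵐ ω ∂μ, Tendsto (fun n : ℕ => gwNormalized m ξ (n : ℕ∞) ω) atTop
              (𝓝 (gwNormalized m ξ ⊤ ω))) ∧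
            ∀ (n : ℕ∞) (x : ℝ), 0 ≤ x →
              μ.real {ω | x ≤ gwNormalized m ξ n ω} ≤
                c₁ * Real.exp (-c₂ * ((m - 1) / m) * (x / d)) := by
  refine ⟨2, (Real.log 3 - 1) / 40, two_pos, by linarith [log_three_sub_one_pos], rfl, rfl, ?_⟩
  intro m d p hm _ hp hmean Ω _ μ _ ξ hξ hlaw hind
  have hmd : m ≤ d := hmean ▸ integral_natCast_le hp
  have hmgf : ∀ n i, HasMobiusMGF (fun ω => (ξ n i ω : ℝ)) m d μ := fun n i =>
    .comp_of_map (hξ n i).aemeasurable (by rw [hlaw, ← hmean]; exact hasMobiusMGF_natCast hp)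
      measurable_from_nat
  obtain ⟨hlim, htail⟩ := theorem1_general hm hmd hξ hmgf hind
  refine ⟨hlim, fun n x hx => (htail n x).trans ?_⟩
  gcongr 2 * Real.exp (?_ * _)
  simpa only [neg_mul, neg_le_neg_iff] using log_three_sub_one_div_mul_le hm
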